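/- Let $n\ge 0$ and $N\ge 0$ be integers, $\alpha\in\mathbb R$, $k_1,\dots,k_N>0$, $x_{0,1},\dots,x_{0,N}\in\mathbb R$; write $t=t_n$, $\partial=\partial/\partial x$ and $\partial^{-1}g(x)=\int_{-\infty}^x g(y)\,dy$. For a function $u$ put $L=-\tfrac14\partial^2-u+\tfrac12\partial^{-1}u_x$, $b_0=0$, $b_1=1$, $b_{i+2}=-\tfrac12L^{i}u$ $(i\ge 0)$ and $a_i=-\tfrac12 b_{i,x}$. The $n$-th KdV equation with $N$ self-consistent sources is the system $$u_{t}=\partial\Big[-2b_{n+2}-2\alpha\sum_{j=1}^N\phi_j^2\Big],\qquad \phi_{j,xx}+(\lambda_j+u)\phi_j=0,\quad j=1,\dots,N,$$ and its auxiliary linear system with constant $\eta$ is $$\psi_{xx}+(\lambda+u)\psi=0,\qquad \psi_{t}=\sum_{i=0}^{n+1}\lambda^{n+1-i}(a_i\psi+b_i\psi_x)+\eta\psi+\alpha\sum_{j=1}^N\phi_j\,\partial^{-1}(\phi_j\psi).$$ By a solution $(u,\phi_1,\dots,\phi_N)$ we mean $C^\infty$ functions on $\mathbb R^2$, tending to $0$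 as $x\to-\infty$ for each $t$, for which the integrals in $b_{n+2}$ converge absolutely. For functions $g_1,\dots,g_m$ put $W_1(g_1,\dots,g_m)=\det F$ and $W_2(g_1,\dots,g_m)=\det G$, where $F_{ij}=\delta_{ij}+\partial^{-1}(g_ig_j)$ for $1\le i,j\le m$, $G_{ij}=F_{ij}$ for $i\le m-1$, and $G_{mj}=g_j$. Let $$f_j=\exp\big(k_jx+(-1)^nk_j^{2n+1}t-\tfrac12\alpha t+x_{0,j}\big),\qquad j=1,\dots,N.$$ Then: (i) $u=0$ is a solution of the $n$-th KdV equation without sources, and each $f_j$ is a smooth solution of the auxiliary linear system for $u=0$ and no sources, with $\lambda=-k_j^2$ and $\eta=-\tfrac12\alpha$. (ii) The integrals $\partial^{-1}(f_if_j)$ converge and $W_1(f_1,\dots,f_N)>0$ on $\mathbb R^2$. (iii) The functions (the $N$-soliton solution) $$u=2\partial^2\ln W_1(f_1,\dots,f_N),\qquad \phi_j=\frac{W_2(f_1,\dots,f_N,f_j)}{W_1(f_1,\dots,f_N)}=\frac{W_2(f_1,\dots,f_{j-1},f_{j+1},\dots,f_N,f_j)}{W_1(f_1,\dots,f_N)},\quad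 j=1,\dots,N,$$ (the last equality being part of the claim) are a solution of the $n$-th KdV equation with $N$ self-consistent sources with $\lambda_j=-k_j^2$. -/

import Mathlib

open scoped ContDiff

namespace KdVSources

/-- The inverse derivative `∂⁻¹ = ∫_{-∞}^x · dx`. -/
noncomputable def antideriv (g : ℝ → ℝ) (x : ℝ) : ℝ :=
  ∫ y in Set.Iic x, g y

/-- The recursion operator `L = -(1/4) ∂² - u + (1/2) ∂⁻¹ u_x` attached to a potential `u(x)`. -/
noncomputable def recOp (u : ℝ → ℝ) (g : ℝ → ℝ) (x : ℝ) : ℝ :=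
  -(1 / 4) * iteratedDeriv 2 g x - u x * g x
    + (1 / 2) * antideriv (fun y => deriv u y * g y) x

/-- The coefficients `b_0 = 0`, `b_1 = 1`, `b_{k+2} = -(1/2) L^k u`. -/
noncomputable def coeffB (u : ℝ → ℝ) : ℕ → ℝ → ℝ
  | 0 => fun _ => 0
  | 1 => fun _ => 1
  | k + 2 => fun x => -(1 / 2) * ((recOp u)^[k] u) x

/-- The coefficients `a_k = -(1/2) b_{k,x}`. -/
noncomputable def coeffA (u : ℝ → ℝ) (k : ℕ) (x : ℝ) : ℝ :=
  -(1 / 2) * deriv (coeffB u k) x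

/-- The operator `A⁽ⁿ⁾(u, lam) = ∑_{i=0}^{n+1} (a_i + b_i ∂) lam^{n+1-i}`. -/
noncomputable def opA (n : ℕ) (u : ℝ → ℝ) (lam : ℝ) (ψ : ℝ → ℝ) (x : ℝ) : ℝ :=
  ∑ i ∈ Finset.range (n + 2),
    (coeffA u i x * ψ x + coeffB u i x * deriv ψ x) * lam ^ (n + 1 - i)

/-- The operator `Q⁽ⁿ'ᴺ⁾ = A⁽ⁿ⁾ + η + α ∑_j φ_j ∂⁻¹ φ_j`. -/
noncomputable def opQ (n : ℕ) {N : ℕ} (α η : ℝ) (u : ℝ → ℝ) (φ : Fin N → ℝ → ℝ)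
    (lam : ℝ) (ψ : ℝ → ℝ) (x : ℝ) : ℝ :=
  opA n u lam ψ x + η * ψ x
    + α * ∑ j, φ j x * antideriv (fun y => φ j y * ψ y) x

/-- `(u, φ_1, …, φ_N)` is a smooth solution on all of space-time, decaying as `x → -∞`, of the
`n`-th KdV equation with `N` self-consistent sources
`u_t = ∂ (-2 b_{n+2} - 2 α ∑ φ_j²)`, `φ_{j,xx} + (lam_j + u) φ_j = 0`.
Functions take the space variable first and the time `t = t_n` second. The field `integrable`
says that all integrals occurring in `b_{n+2} = -(1/2) Lⁿ u` converge; together with `smooth_u`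
it makes every iterate `L^k u`, `k ≤ n`, a smooth function of `x`. -/
structure IsSolution (n : ℕ) {N : ℕ} (α : ℝ) (lam : Fin N → ℝ)
    (u : ℝ → ℝ → ℝ) (φ : Fin N → ℝ → ℝ → ℝ) : Prop where
  smooth_u : ContDiff ℝ ∞ (fun p : ℝ × ℝ => u p.1 p.2)
  smooth_φ : ∀ j, ContDiff ℝ ∞ (fun p : ℝ × ℝ => φ j p.1 p.2)
  decay_u : ∀ t, Filter.Tendsto (fun x => u x t) Filter.atBot (nhds 0)
  decay_φ : ∀ j t, Filter.Tendsto (fun x => φ j x t) Filter.atBot (nhds 0)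
  integrable : ∀ k < n, ∀ x t, MeasureTheory.IntegrableOn
    (fun y => deriv (fun z => u z t) y * ((recOp fun z => u z t)^[k] fun z => u z t) y)
    (Set.Iic x)
  evolution : ∀ x t, deriv (fun s => u x s) t =
    deriv (fun y => -2 * coeffB (fun z => u z t) (n + 2) y
      - 2 * α * ∑ j, (φ j y t) ^ 2) x
  spectral : ∀ j x t,
    iteratedDeriv 2 (fun y => φ j y t) x + (lam j + u x t) * φ j x t = 0

/-- `ψ` is a smooth solution of the auxiliary linear system
`ψ_xx + (lam + u) ψ = 0`, `ψ_t = Q⁽ⁿ'ᴺ⁾ ψ`, the integrals in `Q⁽ⁿ'ᴺ⁾ ψ` being convergent. -/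
structure IsLaxSolution (n : ℕ) {N : ℕ} (α η : ℝ) (u : ℝ → ℝ → ℝ)
    (φ : Fin N → ℝ → ℝ → ℝ) (lam : ℝ) (ψ : ℝ → ℝ → ℝ) : Prop where
  smooth : ContDiff ℝ ∞ (fun p : ℝ × ℝ => ψ p.1 p.2)
  integrable : ∀ j x t,
    MeasureTheory.IntegrableOn (fun y => φ j y t * ψ y t) (Set.Iic x)
  spectral : ∀ x t, iteratedDeriv 2 (fun y => ψ y t) x + (lam + u x t) * ψ x t = 0
  evolution : ∀ x t, deriv (fun s => ψ x s) t =
    opQ n α η (fun y => u y t) (fun j y => φ j y t) lam (fun y => ψ y t) x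

/-- `W_1(g_1, …, g_k) = det F`, `F_{ij} = δ_{ij} + ∂⁻¹(g_i g_j)`. -/
noncomputable def W1 {k : ℕ} (g : Fin k → ℝ → ℝ) (x : ℝ) : ℝ :=
  (Matrix.of fun i j : Fin k =>
    (if i = j then 1 else 0) + antideriv (fun y => g i y * g j y) x).det

/-- `W_2(g_1, …, g_{m+1}) = det G`, where the last row of `G` is `(g_1, …, g_{m+1})` and
`G_{ij} = δ_{ij} + ∂⁻¹(g_i g_j)` in the other rows. -/
noncomputable def W2 {m : ℕ} (g : Fin (m + 1) → ℝ → ℝ) (x : ℝ) : ℝ :=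
  (Matrix.of fun i j : Fin (m + 1) =>
    if i = Fin.last m then g j x
    else (if i = j then 1 else 0) + antideriv (fun y => g i y * g j y) x).det

/-- The list `g_1, …, g_N` followed by one more function `h`. -/
def append {N : ℕ} (g : Fin N → ℝ → ℝ) (h : ℝ → ℝ) : Fin (N + 1) → ℝ → ℝ :=
  fun i => if hi : (i : ℕ) < N then g ⟨i, hi⟩ else h

/-- The list `g_1, …, g_{j-1}, g_{j+1}, …, g_N`. -/
def remove {N : ℕ} (g : Fin N → ℝ → ℝ) (j : Fin N) : Fin (N - 1) → ℝ → ℝ :=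
  fun i => if (i : ℕ) < j then g ⟨i, by omega⟩ else g ⟨i + 1, by omega⟩

end KdVSources

/-! Fix `(x, t)`, put v_i = f_i, K = diag(k_i), A = `gram k v` and y = `dressed k v` = A⁻¹v. Since
∂⁻¹(f_i f_j) = f_i f_j / (k_i + k_j), `W1` is det A, and both quotients `W2 / W1` equal y_j. A is
the identity plus a nonnegative form, so it is always invertible and y is a smooth function of v.

Everything else comes from differentiating A y = v. Along a flow v' = D v with D diagonal, A (y' + D
y) = 2 D y (`gram_mulVec_deriv_dressed`). For the space flow D = K, symmetry of A gives (log det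
A)'' = 2 ∑ k_j y_j², that is u = 4 ∑ k_j y_j²; one more derivative gives the Schrödinger equations
(`deriv_deriv_dressed`). Hence y_j² is an eigenfunction of L with eigenvalue -k_j² (`recOp_sum_sq`),
and Lⁿu = 4 ∑ (-1)ⁿ k_j^(2n+1) y_j².

The time flow has d_j = (-1)ⁿ k_j^(2n+1) - α/2. Symmetry of A, applied to both flows, gives ∑ k_j
y_j y_{j,t} = ∑ d_j y_j y_{j,x} (`sum_deriv_dressed_comm`), so u_t = ∂(4 ∑ d_j y_j²). The first part
of d_j produces -2 b_{n+2}, the part -α/2 produces the source term. -/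

namespace KdVSources

open Matrix MeasureTheory Filter Topology

variable {N : ℕ}

/-! ### The Gram matrix: positivity, inversion, smooth dependence on `v` -/

/-- The matrix `δ_{ij} + v_i v_j / (k_i + k_j)`. -/
noncomputable def gram (k v : Fin N → ℝ) : Matrix (Fin N) (Fin N) ℝ :=
  of fun i j => (if i = j then 1 else 0) + v i * v j / (k i + k j)

/-- The solution `y` of `gram k v *ᵥ y = v`, by Cramer's rule. -/
noncomputable def dressed (k v : Fin N → ℝ) (j : Fin N) : ℝ :=
  ((gram k v).updateRow j v).det / (gram k v).det

theorem integral_exp_mul_Iic_zero {a : ℝ} (ha : 0 < a) :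
    ∫ y in Set.Iic (0 : ℝ), Real.exp (a * y) = 1 / a := by
  simpa using integral_exp_mul_Iic ha 0

/-- Because 1/(k_i + k_j) is the integral of e^{(k_i + k_j) y} over y ≤ 0, the form is the integral
of a square. -/
theorem cauchy_quadratic_form_nonneg (k : Fin N → ℝ) (hk : ∀ j, 0 < k j) (w : Fin N → ℝ) :
    0 ≤ ∑ i, ∑ j, w i * w j / (k i + k j) := by
  have h : ∑ i, ∑ j, w i * w j / (k i + k j)
      = ∫ y in Set.Iic (0 : ℝ), (∑ i, w i * Real.exp (k i * y)) ^ 2 := by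
    have hint : ∀ i j, IntegrableOn (fun y => w i * w j * Real.exp ((k i + k j) * y))
        (Set.Iic (0 : ℝ)) := fun i j =>
      (integrableOn_exp_mul_Iic (add_pos (hk i) (hk j)) 0).const_mul _
    have he : ∀ y, (∑ i, w i * Real.exp (k i * y)) ^ 2
        = ∑ i, ∑ j, w i * w j * Real.exp ((k i + k j) * y) := by
      intro y
      rw [sq, Finset.sum_mul_sum]
      refine Finset.sum_congr rfl fun i _ => Finset.sum_congr rfl fun j _ => ?_
      rw [add_mul, Real.exp_add]
      ring
    simp_rw [he]
    rw [integral_finsetSum _ fun i _ => integrable_finsetSum _ fun j _ => hint i j]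
    refine Finset.sum_congr rfl fun i _ => ?_
    rw [integral_finsetSum _ fun j _ => hint i j]
    refine Finset.sum_congr rfl fun j _ => ?_
    rw [integral_const_mul, integral_exp_mul_Iic_zero (add_pos (hk i) (hk j))]
    ring
  rw [h]
  exact integral_nonneg fun y => sq_nonneg _

theorem gram_mulVec_apply (k v y : Fin N → ℝ) (i : Fin N) :
    (gram k v *ᵥ y) i = y i + ∑ j, v i * v j / (k i + k j) * y j := by
  simp [gram, mulVec, dotProduct, add_mul, Finset.sum_add_distrib]

theorem gram_transpose (k v : Fin N → ℝ) : (gram k v)ᵀ = gram k v := by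
  ext i j
  simp [gram, eq_comm, mul_comm, add_comm]

theorem dotProduct_self_le_gram (k : Fin N → ℝ) (hk : ∀ j, 0 < k j) (v y : Fin N → ℝ) :
    y ⬝ᵥ y ≤ y ⬝ᵥ (gram k v *ᵥ y) := by
  have h := cauchy_quadratic_form_nonneg k hk (fun i => y i * v i)
  have e : y ⬝ᵥ (gram k v *ᵥ y)
      = y ⬝ᵥ y + ∑ i, ∑ j, y i * v i * (y j * v j) / (k i + k j) := by
    simp only [dotProduct, gram_mulVec_apply, mul_add, Finset.sum_add_distrib, Finset.mul_sum]
    congr 1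
    refine Finset.sum_congr rfl fun i _ => Finset.sum_congr rfl fun j _ => ?_
    ring
  linarith

theorem gram_posDef (k : Fin N → ℝ) (hk : ∀ j, 0 < k j) (v : Fin N → ℝ) :
    (gram k v).PosDef := by
  refine PosDef.of_dotProduct_mulVec_pos ?_ fun x hx => ?_
  · rw [IsHermitian, conjTranspose_eq_transpose_of_trivial, gram_transpose]
  · rw [star_trivial]
    refine lt_of_lt_of_le ?_ (dotProduct_self_le_gram k hk v x)
    have : x ⬝ᵥ x ≠ 0 := fun h => hx (dotProduct_self_eq_zero.1 h)
    exact lt_of_le_of_ne (Finset.sum_nonneg fun i _ => mul_self_nonneg _) this.symm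

theorem gram_det_pos (k : Fin N → ℝ) (hk : ∀ j, 0 < k j) (v : Fin N → ℝ) :
    0 < (gram k v).det := (gram_posDef k hk v).det_pos

theorem gram_mulVec_injective (k : Fin N → ℝ) (hk : ∀ j, 0 < k j) (v : Fin N → ℝ) {x y : Fin N → ℝ}
    (h : gram k v *ᵥ x = gram k v *ᵥ y) : x = y :=
  mulVec_injective_of_isUnit
    ((isUnit_iff_isUnit_det _).2 (gram_det_pos k hk v).ne'.isUnit) h

theorem gram_mulVec_dressed (k : Fin N → ℝ) (hk : ∀ j, 0 < k j) (v : Fin N → ℝ) :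
    gram k v *ᵥ dressed k v = v := by
  have h : dressed k v = (gram k v).det⁻¹ • cramer (gram k v) v := by
    ext j
    rw [dressed, ← cramer_transpose_apply, gram_transpose, Pi.smul_apply, smul_eq_mul,
      div_eq_inv_mul]
  rw [h, mulVec_smul, mulVec_cramer, smul_smul, inv_mul_cancel₀ (gram_det_pos k hk v).ne',
    one_smul]

theorem dotProduct_gram_comm (k v x y : Fin N → ℝ) :
    x ⬝ᵥ (gram k v *ᵥ y) = y ⬝ᵥ (gram k v *ᵥ x) := by
  rw [dotProduct_mulVec, ← mulVec_transpose, gram_transpose, dotProduct_comm]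

/-- With A y = v one has |y|² ≤ y·Ay = y·v, and |v - y|² ≥ 0 finishes. This makes the sources square
integrable at -∞, being dominated by exponentials. -/
theorem dotProduct_dressed_le (k : Fin N → ℝ) (hk : ∀ j, 0 < k j) (v : Fin N → ℝ) :
    dressed k v ⬝ᵥ dressed k v ≤ v ⬝ᵥ v := by
  have h1 := dotProduct_self_le_gram k hk v (dressed k v)
  rw [gram_mulVec_dressed k hk v] at h1
  have h2 : 0 ≤ (v - dressed k v) ⬝ᵥ (v - dressed k v) :=
    Finset.sum_nonneg fun i _ => mul_self_nonneg _
  simp only [sub_dotProduct, dotProduct_sub] at h2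
  rw [dotProduct_comm v (dressed k v)] at h2
  linarith

theorem contDiff_det {E : Type*} [NormedAddCommGroup E] [NormedSpace ℝ E]
    {M : E → Matrix (Fin N) (Fin N) ℝ} (h : ∀ i j, ContDiff ℝ ∞ fun x => M x i j) :
    ContDiff ℝ ∞ fun x => (M x).det := by
  simp_rw [det_apply']
  exact ContDiff.sum fun σ _ => contDiff_const.mul (contDiff_prod fun i _ => h _ _)

theorem contDiff_gram (k : Fin N → ℝ) (i j : Fin N) :
    ContDiff ℝ ∞ fun v : Fin N → ℝ => gram k v i j :=
  contDiff_const.add (((contDiff_apply ℝ ℝ i).mul (contDiff_apply ℝ ℝ j)).div_const _)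

theorem contDiff_dressed (k : Fin N → ℝ) (hk : ∀ j, 0 < k j) (j : Fin N) :
    ContDiff ℝ ∞ fun v => dressed k v j := by
  refine ContDiff.div (contDiff_det fun a b => ?_) (contDiff_det (contDiff_gram k))
    fun v => (gram_det_pos k hk v).ne'
  by_cases h : a = j
  · subst h
    simpa using contDiff_apply ℝ ℝ b
  · simpa [updateRow_apply, h] using contDiff_gram k a b

theorem dressed_zero (k : Fin N → ℝ) (hk : ∀ j, 0 < k j) : dressed k 0 = 0 :=
  gram_mulVec_injective k hk 0 (by rw [gram_mulVec_dressed k hk, mulVec_zero])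

/-! ### Differentiating A y = v along diagonal flows -/

/-- If `v_i' = d_i v_i`, then `y = dressed k v` satisfies `gram k v (y' + d y) = 2 d y`. -/
theorem gram_mulVec_deriv_dressed (k : Fin N → ℝ) (hk : ∀ j, 0 < k j) (d : Fin N → ℝ)
    {v : ℝ → Fin N → ℝ} {s : ℝ} (hv : ∀ i, HasDerivAt (fun s => v s i) (d i * v s i) s)
    {y' : Fin N → ℝ} (hy : ∀ i, HasDerivAt (fun s => dressed k (v s) i) (y' i) s) :
    gram k (v s) *ᵥ (fun i => y' i + d i * dressed k (v s) i)
      = fun i => 2 * (d i * dressed k (v s) i) := by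
  ext i
  have hE : ∀ s, dressed k (v s) i
      + ∑ j, v s i * v s j / (k i + k j) * dressed k (v s) j = v s i := fun s => by
    rw [← gram_mulVec_apply, gram_mulVec_dressed k hk]
  have hD := (hy i).add (HasDerivAt.fun_sum fun j (_ : j ∈ Finset.univ) =>
    ((((hv i).mul (hv j)).div_const (k i + k j)).mul (hy j)))
  have hU := hD.unique ((hv i).congr_of_eventuallyEq (Eventually.of_forall fun s => hE s))
  have hs := hE s
  rw [gram_mulVec_apply]
  have e : ∑ j, v s i * v s j / (k i + k j) * (y' j + d j * dressed k (v s) j)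
      = ∑ j, ((d i * v s i * v s j + v s i * (d j * v s j)) / (k i + k j) * dressed k (v s) j
        + v s i * v s j / (k i + k j) * y' j)
        - d i * ∑ j, v s i * v s j / (k i + k j) * dressed k (v s) j := by
    rw [Finset.mul_sum, ← Finset.sum_sub_distrib]
    refine Finset.sum_congr rfl fun j _ => ?_
    ring
  rw [e]
  simp only [Pi.mul_apply] at hU
  linear_combination hU - d i * hs

/-- The displacement identity A K + K A = 2K + v vᵀ, applied to `y`: the factor k_i + k_j cancels
the Cauchy denominator. -/
theorem gram_mul_add_mul_gram (k : Fin N → ℝ) (hk : ∀ j, 0 < k j) (v y : Fin N → ℝ) (i : Fin N) :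
    (gram k v *ᵥ fun j => k j * y j) i + k i * (gram k v *ᵥ y) i
      = 2 * (k i * y i) + v i * (v ⬝ᵥ y) := by
  simp only [gram_mulVec_apply, dotProduct, Finset.mul_sum, mul_add]
  have : ∑ j, v i * v j / (k i + k j) * (k j * y j)
      + ∑ j, k i * (v i * v j / (k i + k j) * y j) = ∑ j, v i * (v j * y j) := by
    rw [← Finset.sum_add_distrib]
    refine Finset.sum_congr rfl fun j _ => ?_
    have := (add_pos (hk i) (hk j)).ne'
    field_simp
    ring
  linarith

theorem hasDerivAt_det {M : ℝ → Matrix (Fin N) (Fin N) ℝ} {M' : Matrix (Fin N) (Fin N) ℝ} {x : ℝ}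
    (h : ∀ i j, HasDerivAt (fun x => M x i j) (M' i j) x) :
    HasDerivAt (fun x => (M x).det) (∑ i, ((M x).updateRow i (M' i)).det) x := by
  let D : ContinuousMultilinearMap ℝ (fun _ : Fin N => Fin N → ℝ) ℝ :=
    { (detRowAlternating (n := Fin N) (R := ℝ)).toMultilinearMap with
      cont := Continuous.matrix_det continuous_id }
  have hM : HasDerivAt (fun x => (fun i j => M x i j : Fin N → Fin N → ℝ)) (fun i j => M' i j) x :=
    hasDerivAt_pi.2 fun i => hasDerivAt_pi.2 fun j => h i j
  have := (D.hasFDerivAt (fun i j => M x i j)).comp_hasDerivAt x hM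
  rw [ContinuousMultilinearMap.linearDeriv_apply] at this
  exact this

/-- Along the space flow A' = v vᵀ, so differentiating row i replaces it by v_i v, and Cramer's rule
turns that determinant into v_i y_i det A. -/
theorem hasDerivAt_gram_det (k : Fin N → ℝ) (hk : ∀ j, 0 < k j) {v : ℝ → Fin N → ℝ} {x : ℝ}
    (hv : ∀ i, HasDerivAt (fun x => v x i) (k i * v x i) x) :
    HasDerivAt (fun x => (gram k (v x)).det)
      ((gram k (v x)).det * (v x ⬝ᵥ dressed k (v x))) x := by
  have h := hasDerivAt_det (M := fun x => gram k (v x)) (M' := of fun i j => v x i * v x j)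
    (x := x) fun i j => by
      refine (((hv i).mul (hv j)).div_const (k i + k j)).const_add _ |>.congr_deriv ?_
      have := (add_pos (hk i) (hk j)).ne'
      simp only [of_apply]
      field_simp
  convert h using 1
  rw [dotProduct, Finset.mul_sum]
  refine Finset.sum_congr rfl fun i _ => ?_
  have e : (of fun i j => v x i * v x j) i = v x i • v x := rfl
  rw [e, det_updateRow_smul, dressed]
  have := (gram_det_pos k hk (v x)).ne'
  field_simp

/-- Write v = A y and move A across the dot product. -/
theorem dotProduct_deriv_dressed (k : Fin N → ℝ) (hk : ∀ j, 0 < k j)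
    {v : ℝ → Fin N → ℝ} {x : ℝ} (hv : ∀ i, HasDerivAt (fun x => v x i) (k i * v x i) x)
    {y' : Fin N → ℝ} (hy : ∀ i, HasDerivAt (fun x => dressed k (v x) i) (y' i) x) :
    v x ⬝ᵥ (fun i => y' i + k i * dressed k (v x) i)
      = 2 * ∑ j, k j * dressed k (v x) j ^ 2 := by
  have h := dotProduct_gram_comm k (v x) (fun i => y' i + k i * dressed k (v x) i)
    (dressed k (v x))
  rw [gram_mulVec_dressed k hk, gram_mulVec_deriv_dressed k hk k hv hy, dotProduct_comm] at h
  rw [h, dotProduct, Finset.mul_sum]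
  exact Finset.sum_congr rfl fun i _ => by ring

/-- If `v_i' = k_i v_i`, then `y = dressed k v` solves the Schrödinger equations
`y_i'' = (k_i ^ 2 - q) y_i` with the potential `q = 4 ∑ k_j y_j ^ 2`. -/
theorem deriv_deriv_dressed (k : Fin N → ℝ) (hk : ∀ j, 0 < k j) {v : ℝ → Fin N → ℝ} {x : ℝ}
    (hv : ∀ x i, HasDerivAt (fun x => v x i) (k i * v x i) x)
    {y' : ℝ → Fin N → ℝ} (hy : ∀ x i, HasDerivAt (fun x => dressed k (v x) i) (y' x i) x)
    {y'' : Fin N → ℝ} (hy' : ∀ i, HasDerivAt (fun x => y' x i) (y'' i) x) (i : Fin N) :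
    y'' i = (k i ^ 2 - 4 * ∑ j, k j * dressed k (v x) j ^ 2) * dressed k (v x) i := by
  set q := 4 * ∑ j, k j * dressed k (v x) j ^ 2 with hq
  suffices h : y'' = fun i => (k i ^ 2 - q) * dressed k (v x) i from congrFun h i
  -- It suffices to compare both sides after applying A.
  refine gram_mulVec_injective k hk (v x) (funext fun i => ?_)
  set y := dressed k (v x) with hyd
  have hE : ∀ x, (y' x i + k i * dressed k (v x) i) + ∑ j, v x i * v x j / (k i + k j)
      * (y' x j + k j * dressed k (v x) j) = 2 * (k i * dressed k (v x) i) := fun x => by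
    have := congrFun (gram_mulVec_deriv_dressed k hk k (hv x) (hy x)) i
    rwa [gram_mulVec_apply] at this
  have hp : ∀ i, HasDerivAt (fun x => y' x i + k i * dressed k (v x) i) (y'' i + k i * y' x i) x :=
    fun i => (hy' i).add ((hy x i).const_mul (k i))
  have hD := (hp i).add (HasDerivAt.fun_sum fun j (_ : j ∈ Finset.univ) =>
    ((((hv x i).mul (hv x j)).div_const (k i + k j)).mul (hp j)))
  have hU := hD.unique ((((hy x i).const_mul (k i)).const_mul 2).congr_of_eventuallyEq
    (Eventually.of_forall fun x => hE x))
  simp only [Pi.mul_apply, Finset.sum_add_distrib] at hU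
  -- The derivative of A is the rank-one matrix v vᵀ.
  have hS : ∑ j, (k i * v x i * v x j + v x i * (k j * v x j)) / (k i + k j)
      * (y' x j + k j * dressed k (v x) j)
      = v x i * (v x ⬝ᵥ fun i => y' x i + k i * dressed k (v x) i) := by
    rw [dotProduct, Finset.mul_sum]
    refine Finset.sum_congr rfl fun j _ => ?_
    have := (add_pos (hk i) (hk j)).ne'
    field_simp
  rw [hS, dotProduct_deriv_dressed k hk (hv x) (hy x)] at hU
  have h1 : (gram k (v x) *ᵥ fun j => y'' j + k j * y' x j) i
      = 2 * (k i * y' x i) - v x i * (q / 2) := by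
    rw [gram_mulVec_apply]
    linarith
  -- The displacement identity, at y' and at K y, commutes K past A: it expresses A K y' and A K² y
  -- through K A y' and K A K y, whose sum is known from `h4`.
  have h2 := gram_mul_add_mul_gram k hk (v x) (y' x) i
  have h3 := gram_mul_add_mul_gram k hk (v x) (fun j => k j * y j) i
  have h4 := congrFun (gram_mulVec_deriv_dressed k hk k (hv x) (hy x)) i
  have h5 := dotProduct_deriv_dressed k hk (hv x) (hy x)
  have h6 := congrFun (gram_mulVec_dressed k hk (v x)) i
  have a1 : (fun j => y'' j + k j * y' x j) = y'' + fun j => k j * y' x j := rfl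
  have a2 : (fun j => y' x j + k j * dressed k (v x) j) = y' x + fun j => k j * y j := rfl
  have a3 : (fun j => (k j ^ 2 - q) * y j) = (fun j => k j * (k j * y j)) - q • y := by
    ext j
    simp only [Pi.sub_apply, Pi.smul_apply, smul_eq_mul]
    ring
  rw [a1, mulVec_add, Pi.add_apply] at h1
  rw [a2, mulVec_add, Pi.add_apply] at h4
  rw [a2, dotProduct_add] at h5
  rw [a3, mulVec_sub, mulVec_smul, Pi.sub_apply, Pi.smul_apply, smul_eq_mul]
  rw [← hyd] at h6 h4 h5
  linear_combination h1 - h2 - h3 + k i * h4 - v x i * h5 + q * h6 + v x i * (1 / 2) * hq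

/-- Derivatives of `dressed k v` along two flows `v_i' = d_i v_i` and `v_i' = k_i v_i`. -/
theorem sum_deriv_dressed_comm (k : Fin N → ℝ) (hk : ∀ j, 0 < k j) (d : Fin N → ℝ)
    {v w : ℝ → Fin N → ℝ} {s r : ℝ} (h : v s = w r)
    (hv : ∀ i, HasDerivAt (fun s => v s i) (d i * v s i) s)
    (hw : ∀ i, HasDerivAt (fun s => w s i) (k i * w r i) r)
    {y' z' : Fin N → ℝ} (hy : ∀ i, HasDerivAt (fun s => dressed k (v s) i) (y' i) s)
    (hz : ∀ i, HasDerivAt (fun s => dressed k (w s) i) (z' i) r) :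
    ∑ i, k i * dressed k (v s) i * y' i = ∑ i, d i * dressed k (v s) i * z' i := by
  have h1 := gram_mulVec_deriv_dressed k hk d hv hy
  have h2 := gram_mulVec_deriv_dressed k hk k hw hz
  rw [← h] at h2
  -- Pairing the two flow identities through the symmetric A; the terms containing both `k` and `d`
  -- cancel.
  have h3 := dotProduct_gram_comm k (v s) (fun i => z' i + k i * dressed k (v s) i)
    (fun i => y' i + d i * dressed k (v s) i)
  rw [h1, h2] at h3
  simp only [dotProduct] at h3
  have h4 := sub_eq_zero.2 h3
  rw [← Finset.sum_sub_distrib] at h4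
  have h5 : ∑ i, (k i * dressed k (v s) i * y' i - d i * dressed k (v s) i * z' i) = 0 := by
    rw [← mul_right_inj' (two_ne_zero (α := ℝ)), mul_zero, Finset.mul_sum, ← neg_eq_zero, ← h4,
      ← Finset.sum_neg_distrib]
    exact Finset.sum_congr rfl fun i _ => by ring
  rw [Finset.sum_sub_distrib] at h5
  linarith

/-! ### The determinants `W1` and `W2` in terms of the Gram matrix -/

theorem det_updateRow_gram (k : Fin N → ℝ) (hk : ∀ j, 0 < k j) (v : Fin N → ℝ) (j : Fin N) :
    ((gram k v).updateRow j v).det = (gram k v).det * dressed k v j := by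
  rw [dressed, mul_div_cancel₀ _ (gram_det_pos k hk v).ne']

theorem W1_eq_det_gram (k : Fin N → ℝ) (g : Fin N → ℝ → ℝ)
    (hg : ∀ i j x, antideriv (fun y => g i y * g j y) x = g i x * g j x / (k i + k j)) (x : ℝ) :
    W1 g x = (gram k fun i => g i x).det := by
  simp only [W1, gram, hg]

/-- Schur complement of the block A: the value is det A · (v_j - vᵀA⁻¹c), where c is the upper part
of the last column. -/
theorem W2_append (k : Fin N → ℝ) (hk : ∀ j, 0 < k j) (g : Fin N → ℝ → ℝ)
    (hg : ∀ i j x, antideriv (fun y => g i y * g j y) x = g i x * g j x / (k i + k j))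
    (j : Fin N) (x : ℝ) :
    W2 (append g (g j)) x = (gram k fun i => g i x).det * dressed k (fun i => g i x) j := by
  set v : Fin N → ℝ := fun i => g i x with hv
  have hdet := gram_det_pos k hk v
  let A := gram k v
  let _ : Invertible A := invertibleOfIsUnitDet A hdet.ne'.isUnit
  have happ : ∀ i : Fin N, append g (g j) (Fin.castSucc i) = g i := fun i => by simp [append]
  have hlast : append g (g j) (Fin.last N) = g j := by simp [append]
  have hW : W2 (append g (g j)) x
      = (fromBlocks A (replicateCol (Fin 1) fun i => v i * v j / (k i + k j))
          (replicateRow (Fin 1) v) (of fun _ _ => v j)).det := by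
    rw [W2, ← det_submatrix_equiv_self finSumFinEquiv]
    congr 1
    ext a b
    rcases a with a | a <;> rcases b with b | b
    · have e1 : (Fin.castAdd 1 a) = Fin.castSucc a := rfl
      have e2 : (Fin.castAdd 1 b) = Fin.castSucc b := rfl
      simp [e1, e2, happ, hg, A, gram, (Fin.castSucc_lt_last a).ne, hv]
    · have e1 : (Fin.castAdd 1 a) = Fin.castSucc a := rfl
      have e2 : (Fin.natAdd N b) = Fin.last N := by ext; simp
      simp [e1, e2, happ, hlast, hg, (Fin.castSucc_lt_last a).ne, hv]
    · have e1 : (Fin.natAdd N a) = Fin.last N := by ext; simp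
      have e2 : (Fin.castAdd 1 b) = Fin.castSucc b := rfl
      simp [e1, e2, happ, hv]
    · have e1 : (Fin.natAdd N a) = Fin.last N := by ext; simp
      have e2 : (Fin.natAdd N b) = Fin.last N := by ext; simp
      simp [e1, e2, hlast, hv]
  rw [hW, det_fromBlocks₁₁]
  congr 1
  rw [det_unique]
  -- The appended copy of `g j` has a new index, so its column carries no δ: it is (A - 1)e_j. Hence
  -- vᵀA⁻¹c = y·(A e_j - e_j) = v_j - y_j.
  have hcol : (fun i => v i * v j / (k i + k j)) = A *ᵥ Pi.single j 1 - Pi.single j 1 := by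
    ext i
    simp [A, gram, Pi.single_apply]
  have hsol : A *ᵥ dressed k v = v := gram_mulVec_dressed k hk v
  have hrow : v ᵥ* ⅟A = dressed k v := by
    have : v = dressed k v ᵥ* A := by
      rw [← mulVec_transpose, gram_transpose, hsol]
    rw [this, vecMul_vecMul, mul_invOf_self, vecMul_one]
    rw [← this]
  have hval : (replicateRow (Fin 1) v * ⅟A
      * replicateCol (Fin 1) fun i => v i * v j / (k i + k j)) default default
      = (v ᵥ* ⅟A) ⬝ᵥ fun i => v i * v j / (k i + k j) := by
    rw [← replicateRow_vecMul]
    rfl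
  rw [Matrix.sub_apply, hval, hrow, hcol, dotProduct_sub, dotProduct_gram_comm, hsol]
  simp

/-- Moving index `j` to the end permutes rows and columns alike, so no sign appears; the matrix is A
with row `j` replaced by v, as in Cramer's rule. -/
theorem W2_append_remove (k : Fin N → ℝ) (hk : ∀ j, 0 < k j) (g : Fin N → ℝ → ℝ)
    (hg : ∀ i j x, antideriv (fun y => g i y * g j y) x = g i x * g j x / (k i + k j))
    (j : Fin N) (x : ℝ) :
    W2 (append (remove g j) (g j)) x
      = (gram k fun i => g i x).det * dressed k (fun i => g i x) j := by
  cases N with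
  | zero => exact j.elim0
  | succ M =>
    rw [← det_updateRow_gram k hk]
    let σ : Fin (M + 1) ≃ Fin (M + 1) := finSuccEquivLast.trans (finSuccEquiv' j).symm
    have hσ : ∀ i : Fin M, σ (Fin.castSucc i) = j.succAbove i := fun i => by simp [σ]
    have hσl : σ (Fin.last M) = j := by simp [σ]
    have happ : ∀ i : Fin (M + 1), append (remove g j) (g j) i = g (σ i) := by
      intro i
      refine Fin.lastCases ?_ (fun i => ?_) i
      · rw [hσl]
        simp [append]
      · rw [hσ]
        simp only [append, remove, Fin.val_castSucc, Nat.add_sub_cancel, i.2, dite_true]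
        split_ifs with h
        · rw [Fin.succAbove_of_castSucc_lt _ _ (by simpa [Fin.lt_def] using h)]
          rfl
        · rw [Fin.succAbove_of_le_castSucc _ _ (by simpa [Fin.le_def] using h)]
          rfl
    rw [W2, ← det_submatrix_equiv_self σ ((gram k fun i => g i x).updateRow j _)]
    congr 1
    ext a b
    have hlast : a = Fin.last M ↔ σ a = j := by
      rw [← hσl, σ.apply_eq_iff_eq]
    have hab : a = b ↔ σ a = σ b := σ.apply_eq_iff_eq.symm
    simp only [of_apply, submatrix_apply, updateRow_apply, gram]
    rw [happ a, happ b]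
    simp only [hg, hab, ← hlast]
    rfl

/-! ### Squared eigenfunctions of the recursion operator -/

section Recursion

variable (k : Fin N → ℝ) {u : ℝ → ℝ} {φ φ' : Fin N → ℝ → ℝ}
  (hu : ∀ x, u x = 4 * ∑ j, k j * φ j x ^ 2)
  (hφ : ∀ j x, HasDerivAt (φ j) (φ' j x) x)
  (hφ' : ∀ j x, HasDerivAt (φ' j) ((k j ^ 2 - u x) * φ j x) x)
  (h0 : ∀ j, Tendsto (φ j) atBot (𝓝 0)) (h0' : ∀ j, Tendsto (φ' j) atBot (𝓝 0))
  (hint : ∀ j x, IntegrableOn (fun y => φ j y ^ 2) (Set.Iic x))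

include hu hφ in
theorem hasDerivAt_potential (x : ℝ) :
    HasDerivAt u (8 * ∑ j, k j * φ j x * φ' j x) x := by
  have h := (HasDerivAt.fun_sum fun j (_ : j ∈ Finset.univ) =>
    ((hφ j x).fun_pow 2).const_mul (k j)).const_mul (4 : ℝ)
  refine (h.congr_of_eventuallyEq (Eventually.of_forall hu)).congr_deriv ?_
  rw [Finset.mul_sum, Finset.mul_sum]
  refine Finset.sum_congr rfl fun j _ => ?_
  simp
  ring

include hu h0 in
theorem tendsto_potential : Tendsto u atBot (𝓝 0) := by
  have h : Tendsto (fun x => 4 * ∑ j, k j * φ j x ^ 2) atBot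
      (𝓝 (4 * ∑ j : Fin N, k j * (0 : ℝ) ^ 2)) :=
    (tendsto_finsetSum _ fun j _ => ((h0 j).pow 2).const_mul _).const_mul _
  simpa [← hu] using h

include hu hφ h0 h0' in
theorem tendsto_deriv_potential : Tendsto (deriv u) atBot (𝓝 0) := by
  have h : Tendsto (fun x => 8 * ∑ j, k j * φ j x * φ' j x) atBot
      (𝓝 (8 * ∑ j : Fin N, k j * (0 : ℝ) * 0)) :=
    (tendsto_finsetSum _ fun j _ => ((h0 j).const_mul _).mul (h0' j)).const_mul _
  have e : deriv u = fun x => 8 * ∑ j, k j * φ j x * φ' j x :=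
    funext fun x => (hasDerivAt_potential k hu hφ x).deriv
  rw [e]
  simpa using h

include hu hφ hφ' h0 h0' hint in
-- Near -∞ the factor u_x is bounded and φ_j² is integrable; elsewhere continuity suffices.
theorem integrableOn_deriv_potential_mul_sq (j : Fin N) (x : ℝ) :
    IntegrableOn (fun y => deriv u y * φ j y ^ 2) (Set.Iic x) := by
  have e : deriv u = fun x => 8 * ∑ j, k j * φ j x * φ' j x :=
    funext fun x => (hasDerivAt_potential k hu hφ x).deriv
  have c : ∀ j, Continuous (φ j) := fun j =>
    continuous_iff_continuousAt.2 fun x => (hφ j x).continuousAt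
  have c' : ∀ j, Continuous (φ' j) := fun j =>
    continuous_iff_continuousAt.2 fun x => (hφ' j x).continuousAt
  have hc : Continuous fun y => deriv u y * φ j y ^ 2 := by
    rw [e]
    fun_prop
  refine hc.locallyIntegrable.locallyIntegrableOn _ |>.integrableOn_of_isBigO_atBot
    (g := fun y => φ j y ^ 2) ?_ ⟨Set.Iic x, Iic_mem_atBot x, hint j x⟩
  have := ((tendsto_deriv_potential k hu hφ h0 h0').isBigO_one ℝ).mul
    (Asymptotics.isBigO_refl (fun y => φ j y ^ 2) atBot)
  simpa using this

include hu hφ hφ' h0 h0' hint in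
-- By the Schrödinger equation the right-hand side is a primitive of u_x φ_j², and it vanishes at
-- -∞.
theorem antideriv_deriv_potential_mul_sq (j : Fin N) (x : ℝ) :
    antideriv (fun y => deriv u y * φ j y ^ 2) x
      = φ' j x ^ 2 - (k j ^ 2 - u x) * φ j x ^ 2 := by
  have hd : ∀ y, HasDerivAt (fun y => φ' j y ^ 2 - (k j ^ 2 - u y) * φ j y ^ 2)
      (deriv u y * φ j y ^ 2) y := fun y => by
    have hU := hasDerivAt_potential k hu hφ y
    refine (((hφ' j y).fun_pow 2).sub ((hU.const_sub (k j ^ 2)).mul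
      ((hφ j y).fun_pow 2))).congr_deriv ?_
    rw [hU.deriv]
    simp
    ring
  have hl : Tendsto (fun y => φ' j y ^ 2 - (k j ^ 2 - u y) * φ j y ^ 2) atBot (𝓝 0) := by
    have := ((h0' j).pow 2).sub
      (((tendsto_potential k hu h0).const_sub (k j ^ 2)).mul ((h0 j).pow 2))
    simpa using this
  rw [antideriv, integral_Iic_of_hasDerivAt_of_tendsto' (fun y _ => hd y)
    (integrableOn_deriv_potential_mul_sq k hu hφ hφ' h0 h0' hint j x) hl, sub_zero]

include hu hφ hφ' h0 h0' hint in
/-- The squared eigenfunctions are eigenfunctions of the recursion operator. -/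
theorem recOp_sum_sq (c : Fin N → ℝ) :
    recOp u (fun x => ∑ j, c j * φ j x ^ 2) = fun x => ∑ j, -(k j ^ 2) * c j * φ j x ^ 2 := by
  have d1 : deriv (fun x => ∑ j, c j * φ j x ^ 2) = fun x => ∑ j, c j * (2 * φ j x * φ' j x) := by
    funext x
    refine (HasDerivAt.fun_sum fun j _ => ((hφ j x).fun_pow 2).const_mul (c j)).deriv.trans ?_
    simp
  have d2 : ∀ x, iteratedDeriv 2 (fun x => ∑ j, c j * φ j x ^ 2) x
      = ∑ j, c j * (2 * φ' j x * φ' j x + 2 * φ j x * ((k j ^ 2 - u x) * φ j x)) := by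
    intro x
    rw [iteratedDeriv_succ, iteratedDeriv_one, d1]
    exact (HasDerivAt.fun_sum fun j _ =>
      ((((hφ j x).const_mul 2).mul (hφ' j x)).const_mul (c j))).deriv
  have hA : ∀ x, antideriv (fun y => deriv u y * ∑ j, c j * φ j y ^ 2) x
      = ∑ j, c j * (φ' j x ^ 2 - (k j ^ 2 - u x) * φ j x ^ 2) := by
    intro x
    have e : (fun y => deriv u y * ∑ j, c j * φ j y ^ 2)
        = fun y => ∑ j, c j * (deriv u y * φ j y ^ 2) := by
      funext y
      rw [Finset.mul_sum]
      exact Finset.sum_congr rfl fun j _ => by ring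
    rw [antideriv, e, integral_finsetSum _ fun j _ =>
      (integrableOn_deriv_potential_mul_sq k hu hφ hφ' h0 h0' hint j x).const_mul _]
    refine Finset.sum_congr rfl fun j _ => ?_
    rw [integral_const_mul, ← antideriv,
      antideriv_deriv_potential_mul_sq k hu hφ hφ' h0 h0' hint]
  funext x
  rw [recOp, d2, hA, Finset.mul_sum, Finset.mul_sum, Finset.mul_sum]
  rw [← Finset.sum_sub_distrib, ← Finset.sum_add_distrib]
  exact Finset.sum_congr rfl fun j _ => by ring

include hu hφ hφ' h0 h0' hint in
theorem recOp_iterate_potential (m : ℕ) :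
    (recOp u)^[m] u = fun x => ∑ j, 4 * (-1) ^ m * k j ^ (2 * m + 1) * φ j x ^ 2 := by
  induction m with
  | zero =>
    funext x
    simp [hu, Finset.mul_sum, mul_assoc]
  | succ m ih =>
    rw [Function.iterate_succ_apply', ih, recOp_sum_sq k hu hφ hφ' h0 h0' hint]
    funext x
    exact Finset.sum_congr rfl fun j _ => by ring

include hu hφ hφ' h0 h0' hint in
theorem integrableOn_deriv_mul_recOp_iterate (m : ℕ) (x : ℝ) :
    IntegrableOn (fun y => deriv u y * ((recOp u)^[m] u) y) (Set.Iic x) := by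
  rw [recOp_iterate_potential k hu hφ hφ' h0 h0' hint]
  have e : (fun y => deriv u y * ∑ j, 4 * (-1) ^ m * k j ^ (2 * m + 1) * φ j y ^ 2)
      = fun y => ∑ j, 4 * (-1) ^ m * k j ^ (2 * m + 1) * (deriv u y * φ j y ^ 2) := by
    funext y
    rw [Finset.mul_sum]
    exact Finset.sum_congr rfl fun j _ => by ring
  rw [e]
  exact integrable_finsetSum _ fun j _ =>
    (integrableOn_deriv_potential_mul_sq k hu hφ hφ' h0 h0' hint j x).const_mul _

end Recursion

/-! ### The zero seed -/

theorem recOp_zero : recOp (fun _ => 0) (fun _ => 0) = fun _ => 0 := by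
  funext x
  simp [recOp, antideriv]

theorem recOp_iterate_zero (m : ℕ) : (recOp fun _ => 0)^[m] (fun _ => 0) = fun _ => 0 :=
  Function.iterate_fixed recOp_zero m

theorem isSolution_zero (n : ℕ) (α : ℝ) :
    IsSolution n α (Fin.elim0 : Fin 0 → ℝ) (fun _ _ => 0) Fin.elim0 where
  smooth_u := contDiff_const
  smooth_φ j := j.elim0
  decay_u _ := tendsto_const_nhds
  decay_φ j := j.elim0
  integrable m _ x t := by simp
  evolution x t := by simp [coeffB, recOp_iterate_zero]
  spectral j := j.elim0

/-- For u = 0 only b_1 = 1 survives, with weight lam^(n+1-1). -/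
theorem opA_zero (n : ℕ) (lam : ℝ) (ψ : ℝ → ℝ) (x : ℝ) :
    opA n (fun _ => 0) lam ψ x = lam ^ n * deriv ψ x := by
  have h : ∀ i, coeffB (fun _ => 0) (i + 2) = fun _ => 0 := fun i => by
    funext x
    simp [coeffB, recOp_iterate_zero]
  rw [opA, Finset.sum_range_succ', Finset.sum_range_succ']
  simp [coeffA, h]
  simp [coeffB]
  ring

section Exponential

variable {n : ℕ} {α κ c : ℝ} {f : ℝ → ℝ → ℝ}
  (hf : ∀ x t, f x t =
    Real.exp (κ * x + (-1) ^ n * κ ^ (2 * n + 1) * t - (1 / 2) * α * t + c))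

include hf in
theorem hasDerivAt_exp_space (x t : ℝ) : HasDerivAt (fun y => f y t) (κ * f x t) x := by
  simp only [hf]
  refine (((((hasDerivAt_id x).const_mul κ).add_const _).sub_const _).add_const _).exp
    |>.congr_deriv ?_
  simp
  ring

include hf in
theorem hasDerivAt_exp_time (x t : ℝ) : HasDerivAt (fun s => f x s)
    (((-1) ^ n * κ ^ (2 * n + 1) - (1 / 2) * α) * f x t) t := by
  simp only [hf]
  refine ((((hasDerivAt_id t).const_mul _).const_add _).sub
    ((hasDerivAt_id t).const_mul _)).add_const _ |>.exp |>.congr_deriv ?_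
  simp
  ring

include hf in
theorem contDiff_exp : ContDiff ℝ ∞ (fun p : ℝ × ℝ => f p.1 p.2) := by
  simp only [hf]
  fun_prop

include hf in
theorem isLaxSolution_exp :
    IsLaxSolution n α (-(1 / 2) * α) (fun _ _ => 0) (Fin.elim0 : Fin 0 → ℝ → ℝ → ℝ)
      (-κ ^ 2) f := by
  refine ⟨contDiff_exp hf, fun j => j.elim0, fun x t => ?_, fun x t => ?_⟩
  · have e : deriv (fun y => f y t) = fun x => κ * f x t :=
      funext fun x => (hasDerivAt_exp_space hf x t).deriv
    rw [iteratedDeriv_succ, iteratedDeriv_one, e,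
      ((hasDerivAt_exp_space hf x t).const_mul κ).deriv]
    ring
  · rw [(hasDerivAt_exp_time hf x t).deriv, opQ, opA_zero, (hasDerivAt_exp_space hf x t).deriv,
      neg_pow (κ ^ 2), ← pow_mul]
    simp
    ring

end Exponential

/-! ### Exponential integrals, behaviour at -∞ and the logarithm of the determinant -/

theorem exp_mul_exp (a b p q y : ℝ) : Real.exp (a * y + p) * Real.exp (b * y + q)
    = Real.exp (p + q) * Real.exp ((a + b) * y) := by
  simp only [← Real.exp_add]
  ring_nf

theorem integrableOn_exp_mul_exp {a b : ℝ} (hab : 0 < a + b) (p q x : ℝ) :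
    IntegrableOn (fun y => Real.exp (a * y + p) * Real.exp (b * y + q)) (Set.Iic x) := by
  simp only [exp_mul_exp]
  exact (integrableOn_exp_mul_Iic hab x).const_mul _

theorem antideriv_exp_mul_exp {a b : ℝ} (hab : 0 < a + b) (p q x : ℝ) :
    antideriv (fun y => Real.exp (a * y + p) * Real.exp (b * y + q)) x
      = Real.exp (a * x + p) * Real.exp (b * x + q) / (a + b) := by
  simp only [antideriv, exp_mul_exp]
  rw [integral_const_mul, integral_exp_mul_Iic hab, mul_div_assoc]

theorem tendsto_exp_mul_atBot {a : ℝ} (ha : 0 < a) (p : ℝ) :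
    Tendsto (fun x => Real.exp (a * x + p)) atBot (𝓝 0) :=
  Real.tendsto_exp_atBot.comp
    (tendsto_atBot_add_const_right _ _ (tendsto_id.const_mul_atBot ha))

theorem two_mul_iteratedDeriv_log_det_gram (k : Fin N → ℝ) (hk : ∀ j, 0 < k j)
    {v : ℝ → Fin N → ℝ} (hv : ∀ x i, HasDerivAt (fun x => v x i) (k i * v x i) x)
    {y' : ℝ → Fin N → ℝ} (hy : ∀ x i, HasDerivAt (fun x => dressed k (v x) i) (y' x i) x)
    (x : ℝ) :
    2 * iteratedDeriv 2 (fun x => Real.log (gram k (v x)).det) x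
      = 4 * ∑ j, k j * dressed k (v x) j ^ 2 := by
  have d1 : deriv (fun x => Real.log (gram k (v x)).det) = fun x => v x ⬝ᵥ dressed k (v x) := by
    funext x
    rw [((hasDerivAt_gram_det k hk (hv x)).log (gram_det_pos k hk (v x)).ne').deriv,
      mul_div_cancel_left₀ _ (gram_det_pos k hk (v x)).ne']
  have d2 : HasDerivAt (fun x => v x ⬝ᵥ dressed k (v x))
      (2 * ∑ j, k j * dressed k (v x) j ^ 2) x := by
    rw [← dotProduct_deriv_dressed k hk (hv x) (hy x)]
    refine (HasDerivAt.fun_sum fun j (_ : j ∈ Finset.univ) =>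
      (hv x j).mul (hy x j)).congr_deriv ?_
    exact Finset.sum_congr rfl fun j _ => by ring
  rw [iteratedDeriv_succ, iteratedDeriv_one, d1, d2.deriv]
  ring

/-- By the chain rule the derivative is a continuous function of v that vanishes at v = 0. -/
theorem tendsto_deriv_dressed (k : Fin N → ℝ) (hk : ∀ j, 0 < k j)
    {v : ℝ → Fin N → ℝ} (hv : ∀ x i, HasDerivAt (fun x => v x i) (k i * v x i) x)
    (h0 : Tendsto v atBot (𝓝 0)) (j : Fin N) :
    Tendsto (deriv fun x => dressed k (v x) j) atBot (𝓝 0) := by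
  have hs := contDiff_dressed k hk j
  have e : (deriv fun x => dressed k (v x) j)
      = fun x => fderiv ℝ (fun w => dressed k w j) (v x) (k * v x) := by
    funext x
    have hd := (hs.differentiable (by simp) (v x)).hasFDerivAt.comp_hasDerivAt x
      (hasDerivAt_pi.2 (hv x))
    exact hd.deriv
  have hc : Continuous fun w : Fin N → ℝ => fderiv ℝ (fun w => dressed k w j) w (k * w) :=
    (hs.continuous_fderiv (by simp)).clm_apply (continuous_const.mul continuous_id)
  rw [e]
  have := (hc.tendsto 0).comp h0
  simpa [Function.comp_def] using this

/-! ### Assembling the soliton solution -/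

/-- The sources `dressed k v` and the potential `4 ∑ k_j (dressed k v)_j ^ 2` form a solution. -/
theorem isSolution_dressed (n : ℕ) (α : ℝ) (k x₀ : Fin N → ℝ) (hk : ∀ j, 0 < k j)
    (f : Fin N → ℝ → ℝ → ℝ)
    (hf : ∀ j x t, f j x t =
      Real.exp (k j * x + (-1) ^ n * k j ^ (2 * n + 1) * t - (1 / 2) * α * t + x₀ j))
    {u : ℝ → ℝ → ℝ} {φ : Fin N → ℝ → ℝ → ℝ}
    (hφ : ∀ j x t, φ j x t = dressed k (fun i => f i x t) j)
    (hu : ∀ x t, u x t = 4 * ∑ j, k j * φ j x t ^ 2) :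
    IsSolution n α (fun j => -(k j) ^ 2) u φ := by
  have hfx : ∀ t x i, HasDerivAt (fun y => f i y t) (k i * f i x t) x :=
    fun t x i => hasDerivAt_exp_space (hf i) x t
  have hft : ∀ x t i, HasDerivAt (fun s => f i x s)
      (((-1) ^ n * k i ^ (2 * n + 1) - (1 / 2) * α) * f i x t) t :=
    fun x t i => hasDerivAt_exp_time (hf i) x t
  have hf_exp : ∀ j x t, f j x t = Real.exp
      (k j * x + ((-1) ^ n * k j ^ (2 * n + 1) * t - (1 / 2) * α * t + x₀ j)) := fun j x t => by
    rw [hf]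
    ring_nf
  have hφe : ∀ j, φ j = fun x t => dressed k (fun i => f i x t) j :=
    fun j => funext fun x => funext fun t => hφ j x t
  have sφ : ∀ j, ContDiff ℝ ∞ (fun p : ℝ × ℝ => φ j p.1 p.2) := fun j => by
    simp only [hφ]
    exact (contDiff_dressed k hk j).comp (contDiff_pi.2 fun i => contDiff_exp (hf i))
  have su : ContDiff ℝ ∞ (fun p : ℝ × ℝ => u p.1 p.2) := by
    simp only [hu]
    exact contDiff_const.mul (ContDiff.sum fun j _ => contDiff_const.mul ((sφ j).pow 2))
  have sx : ∀ j t, ContDiff ℝ ∞ (fun x => φ j x t) := fun j t =>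
    (sφ j).comp (contDiff_id.prodMk contDiff_const)
  have st : ∀ j x, ContDiff ℝ ∞ (fun s => φ j x s) := fun j x =>
    (sφ j).comp (contDiff_const.prodMk contDiff_id)
  have dx : ∀ j t x, HasDerivAt (fun y => φ j y t) (deriv (fun y => φ j y t) x) x := fun j t x =>
    ((sx j t).differentiable (by simp) x).hasDerivAt
  have dt : ∀ j x t, HasDerivAt (fun s => φ j x s) (deriv (fun s => φ j x s) t) t := fun j x t =>
    ((st j x).differentiable (by simp) t).hasDerivAt
  have dxx0 : ∀ j t x, HasDerivAt (deriv fun y => φ j y t) (deriv (deriv fun y => φ j y t) x) x :=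
    fun j t x => by
      have h : ContDiff ℝ ∞ (deriv fun y => φ j y t) := (contDiff_infty_iff_deriv.1 (sx j t)).2
      exact (h.differentiable (by simp) x).hasDerivAt
  have hxx : ∀ j t x, deriv (deriv fun y => φ j y t) x = (k j ^ 2 - u x t) * φ j x t := by
    intro j t x
    have := deriv_deriv_dressed k hk (v := fun x i => f i x t) (x := x) (hfx t)
      (y' := fun x i => deriv (fun y => φ i y t) x)
      (fun x i => by simpa only [hφ] using dx i t x)
      (y'' := fun i => deriv (deriv fun y => φ i y t) x) (fun i => dxx0 i t x) j
    simpa only [← hφ, ← hu] using this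
  have dxx : ∀ t j x, HasDerivAt (deriv fun y => φ j y t) ((k j ^ 2 - u x t) * φ j x t) x :=
    fun t j x => hxx j t x ▸ dxx0 j t x
  have hv0 : ∀ t, Tendsto (fun x i => f i x t) atBot (𝓝 0) := fun t =>
    tendsto_pi_nhds.2 fun i => by
      simp only [hf_exp]
      exact tendsto_exp_mul_atBot (hk i) _
  have h0 : ∀ t j, Tendsto (fun x => φ j x t) atBot (𝓝 0) := fun t j => by
    have := ((contDiff_dressed k hk j).continuous.tendsto 0).comp (hv0 t)
    simp only [hφ]
    simpa only [Function.comp_def, dressed_zero k hk, Pi.zero_apply] using this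
  have h0' : ∀ t j, Tendsto (deriv fun x => φ j x t) atBot (𝓝 0) := fun t j => by
    have := tendsto_deriv_dressed k hk (hfx t) (hv0 t) j
    simpa only [hφe] using this
  have hint : ∀ t j x, IntegrableOn (fun y => φ j y t ^ 2) (Set.Iic x) := fun t j x => by
    have hg : IntegrableOn (fun y => ∑ i, f i y t * f i y t) (Set.Iic x) := by
      simp only [hf_exp]
      exact integrable_finsetSum _ fun i _ =>
        integrableOn_exp_mul_exp (add_pos (hk i) (hk i)) _ _ x
    refine Integrable.mono' hg ((sx j t).continuous.pow 2).aestronglyMeasurable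
      (Eventually.of_forall fun y => ?_)
    rw [Real.norm_of_nonneg (sq_nonneg _), hφ, sq]
    refine le_trans ?_ (dotProduct_dressed_le k hk fun i => f i y t)
    exact Finset.single_le_sum (f := fun i => dressed k (fun i => f i y t) i
      * dressed k (fun i => f i y t) i) (fun i _ => mul_self_nonneg _) (Finset.mem_univ j)
  refine ⟨su, sφ, fun t => tendsto_potential k (fun x => hu x t) (h0 t), fun j t => h0 t j,
    fun m _ x t => integrableOn_deriv_mul_recOp_iterate k (fun x => hu x t) (fun j x => dx j t x)
      (dxx t) (h0 t) (h0' t) (hint t) m x, fun x t => ?_, fun j x t => ?_⟩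
  · have hL := recOp_iterate_potential k (fun x => hu x t) (fun j x => dx j t x)
      (dxx t) (h0 t) (h0' t) (hint t) n
    -- Here -2 b_{n+2} = Lⁿu, and -2α = 4·(-α/2) merges the sources into the exponents' time rates
    -- d_j.
    have hR : (fun y => -2 * coeffB (fun z => u z t) (n + 2) y - 2 * α * ∑ j, φ j y t ^ 2)
        = fun y => ∑ j, 4 * ((-1) ^ n * k j ^ (2 * n + 1) - (1 / 2) * α) * φ j y t ^ 2 := by
      funext y
      simp only [coeffB, hL]
      rw [← mul_assoc, Finset.mul_sum, Finset.mul_sum, ← Finset.sum_sub_distrib]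
      exact Finset.sum_congr rfl fun j _ => by ring
    have hc := sum_deriv_dressed_comm k hk (fun i => (-1) ^ n * k i ^ (2 * n + 1) - (1 / 2) * α)
      (v := fun s i => f i x s) (w := fun y i => f i y t) (s := t) (r := x) rfl
      (hft x t) (hfx t x) (y' := fun i => deriv (fun s => φ i x s) t)
      (z' := fun i => deriv (fun y => φ i y t) x)
      (fun i => by simpa only [hφ] using dt i x t) (fun i => by simpa only [hφ] using dx i t x)
    simp only [← hφ] at hc
    -- The chain rule for the potential is used here with `t` as the variable.
    have hut : HasDerivAt (fun s => u x s) (8 * ∑ i, k i * φ i x t * deriv (fun s => φ i x s) t) t :=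
      hasDerivAt_potential k (fun s => hu x s) (fun j s => dt j x s) t
    rw [hut.deriv, hc, hR, (HasDerivAt.fun_sum fun j (_ : j ∈ Finset.univ) =>
      ((dx j t x).fun_pow 2).const_mul _).deriv, Finset.mul_sum]
    refine Finset.sum_congr rfl fun j _ => ?_
    simp
    ring
  · rw [iteratedDeriv_succ, iteratedDeriv_one, hxx]
    ring

end KdVSources

theorem mainTheorem3 (n N : ℕ) (α : ℝ) (k x₀ : Fin N → ℝ) (hk : ∀ j, 0 < k j)
    (f : Fin N → ℝ → ℝ → ℝ)
    (hf : ∀ j x t, f j x t =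
      Real.exp (k j * x + (-1) ^ n * k j ^ (2 * n + 1) * t - (1 / 2) * α * t + x₀ j))
    (u : ℝ → ℝ → ℝ)
    (hu : ∀ x t, u x t =
      2 * iteratedDeriv 2 (fun y => Real.log (KdVSources.W1 (fun i z => f i z t) y)) x)
    (φ : Fin N → ℝ → ℝ → ℝ)
    (hφ : ∀ j x t, φ j x t =
      KdVSources.W2 (KdVSources.append (fun i z => f i z t) (fun z => f j z t)) x
        / KdVSources.W1 (fun i z => f i z t) x) :
    -- the seed: `u = 0` without sources, and `f_j` solves its linear system at `-k_j²`
    (KdVSources.IsSolution n α (Fin.elim0 : Fin 0 → ℝ) (fun _ _ => 0) Fin.elim0 ∧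
      ∀ j, KdVSources.IsLaxSolution n α (-(1 / 2) * α) (fun _ _ => 0)
        (Fin.elim0 : Fin 0 → ℝ → ℝ → ℝ) (-(k j) ^ 2) (f j)) ∧
    -- the determinants are well defined and the quotients and the logarithm make sense
    (∀ i j x t, MeasureTheory.IntegrableOn (fun y => f i y t * f j y t) (Set.Iic x)) ∧
    (∀ x t, 0 < KdVSources.W1 (fun i z => f i z t) x) ∧
    -- the two expressions of the sources agree
    (∀ j x t, φ j x t =
      KdVSources.W2 (KdVSources.append (KdVSources.remove (fun i z => f i z t) j)
          (fun z => f j z t)) x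
        / KdVSources.W1 (fun i z => f i z t) x) ∧
    -- the solution with `N` sources
    KdVSources.IsSolution n α (fun j => -(k j) ^ 2) u φ := by
  open KdVSources in
  have hf_exp : ∀ j x t, f j x t = Real.exp
      (k j * x + ((-1) ^ n * k j ^ (2 * n + 1) * t - (1 / 2) * α * t + x₀ j)) := fun j x t => by
    rw [hf]
    ring_nf
  have hg : ∀ t i j x, antideriv (fun y => f i y t * f j y t) x
      = f i x t * f j x t / (k i + k j) := fun t i j x => by
    simp only [hf_exp]
    exact antideriv_exp_mul_exp (add_pos (hk i) (hk j)) _ _ x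
  have hW1 : ∀ t x, W1 (fun i z => f i z t) x = (gram k fun i => f i x t).det := fun t x =>
    W1_eq_det_gram k (fun i z => f i z t) (hg t) x
  have hpos : ∀ t x, 0 < W1 (fun i z => f i z t) x := fun t x =>
    hW1 t x ▸ gram_det_pos k hk _
  have hφd : ∀ j x t, φ j x t = dressed k (fun i => f i x t) j := fun j x t => by
    rw [hφ, W2_append k hk (fun i z => f i z t) (hg t) j x, ← hW1 t x,
      mul_div_cancel_left₀ _ (hpos t x).ne']
  refine ⟨⟨isSolution_zero n α, fun j => isLaxSolution_exp (hf j)⟩, fun i j x t => ?_,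
    fun x t => hpos t x, fun j x t => ?_, isSolution_dressed n α k x₀ hk f hf hφd fun x t => ?_⟩
  · simp only [hf_exp]
    exact integrableOn_exp_mul_exp (add_pos (hk i) (hk j)) _ _ x
  · rw [W2_append_remove k hk (fun i z => f i z t) (hg t) j x, ← hW1 t x,
      mul_div_cancel_left₀ _ (hpos t x).ne', hφd]
  · rw [hu]
    simp only [hW1, hφd]
    refine two_mul_iteratedDeriv_log_det_gram k hk (v := fun x i => f i x t)
      (fun x i => hasDerivAt_exp_space (hf i) x t)
      (y' := fun x i => deriv (fun y => dressed k (fun i => f i y t) i) x) (fun x i => ?_) x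
    have hs : ContDiff ℝ ∞ fun y => dressed k (fun i => f i y t) i :=
      (contDiff_dressed k hk i).comp (contDiff_pi.2 fun i =>
        (contDiff_exp (hf i)).comp (contDiff_id.prodMk contDiff_const))
    exact (hs.differentiable (by simp) x).hasDerivAt
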